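/- Let $G$ be a finite simple graph with vertex set $I=\{\alpha_1,\dots,\alpha_n\}$. Call $\alpha,\beta\in I$ concurrent, written $\alpha\,\zeta\,\beta$, if $\alpha=\beta$ or $\{\alpha,\beta\}$ is an edge of $G$. A heap over $(I,\zeta)$ is a finite set $E\subset I\times\{0,1,2,\dots\}$ of pieces (position, level) such that (a) two different pieces of $E$ with concurrent positions have different levels, and (b) for each $(\alpha,l)\in E$ with $l>0$ there is a piece $(\beta,l-1)\in E$ with $\alpha\,\zeta\,\beta$. The pieces of $E$ are partially ordered by the reflexive transitive closure $\le_E$ of the relation "$(\alpha,l)$ is below $(\beta,m)$ if $\alpha\,\zeta\,\beta$ and $l<m$". A pyramid is a heap with exactly one minimal piece with respect to $\le_E$; its basis is the position of that piece. The weight of $E$ is the vector $\mathbf k\in\mathbb Z_{\ge0}^n$ whose entry $\mathbf k(i)$ is the number of pieces of $E$ in position $\alpha_i$; put $\operatorname{ht}\mathbf k=\sum_{i}\mathbf k(i)$. For $\mathbf k\in\mathbb Z_{\ge 0}^n$ let $\mathcal P_{\mathbf k}$ be the set of pyramids of weight $\mathbf k$, and $\mathcal P^{i}_{\mathbf k}$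 the set of those with basis $\alpha_i$. Lemma (pyramid proportionality lemma) and corollary. For every $\mathbf k\in\mathbb Z_{\ge0}^n$ the sets $\mathcal P_{\mathbf k}$ and $\mathcal P^{i}_{\mathbf k}$ are finite, and: 1. for every $i$ with $\mathbf k(i)\neq0$, $$|\mathcal P_{\mathbf k}|=\frac{\operatorname{ht}\mathbf k}{\mathbf k(i)}\,|\mathcal P^{i}_{\mathbf k}|;$$ 2. for all $i,j$ with $\mathbf k(j)\neq0$, $$|\mathcal P^{i}_{\mathbf k}|=\frac{\mathbf k(i)}{\mathbf k(j)}\,|\mathcal P^{j}_{\mathbf k}|;$$ 3. for all $i,j$, $\ \mathbf k(j)\,|\mathcal P^{i}_{\mathbf k}|=\mathbf k(i)\,|\mathcal P^{j}_{\mathbf k}|$. -/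

import Mathlib

namespace HeapsOfPieces

/-- Two positions are concurrent if they are equal or adjacent in `G`; two distinct
positions commute exactly when they are not adjacent. -/
def Concurrent {V : Type*} (G : SimpleGraph V) (a b : V) : Prop :=
  a = b ∨ G.Adj a b

/-- A pre-heap: a finite set of basic pieces `(position, level)` in which two different pieces
with concurrent positions never have the same level. -/
def IsPreHeap {V : Type*} (G : SimpleGraph V) (E : Finset (V × ℕ)) : Prop :=
  ∀ p ∈ E, ∀ q ∈ E, p ≠ q → Concurrent G p.1 q.1 → p.2 ≠ q.2

/-- A heap: a pre-heap in which every piece of positive level rests on a piece with concurrent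
position one level below. -/
def IsHeap {V : Type*} (G : SimpleGraph V) (E : Finset (V × ℕ)) : Prop :=
  IsPreHeap G E ∧
    ∀ p ∈ E, 0 < p.2 → ∃ q ∈ E, q.2 + 1 = p.2 ∧ Concurrent G p.1 q.1

/-- The generating relation of the order of `E`: `p` and `q` are pieces of `E` with concurrent
positions, and `p` has the smaller level. -/
def Below {V : Type*} (G : SimpleGraph V) (E : Finset (V × ℕ)) (p q : V × ℕ) : Prop :=
  p ∈ E ∧ q ∈ E ∧ Concurrent G p.1 q.1 ∧ p.2 < q.2

/-- The partial order on the pieces of `E`. -/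
def PieceLE {V : Type*} (G : SimpleGraph V) (E : Finset (V × ℕ)) : V × ℕ → V × ℕ → Prop :=
  Relation.ReflTransGen (Below G E)

/-- The minimal pieces of `E`. -/
def minPieces {V : Type*} (G : SimpleGraph V) (E : Finset (V × ℕ)) : Set (V × ℕ) :=
  {p | p ∈ E ∧ ∀ q ∈ E, PieceLE G E q p → q = p}

/-- `E` is a pyramid with basis `a`: a heap with exactly one minimal piece, which is in
position `a`. -/
def IsPyramidWithBasis {V : Type*} (G : SimpleGraph V) (a : V) (E : Finset (V × ℕ)) : Prop :=
  IsHeap G E ∧ ∃ l : ℕ, minPieces G E = {(a, l)}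

/-- A pyramid: a heap with exactly one minimal piece. -/
def IsPyramid {V : Type*} (G : SimpleGraph V) (E : Finset (V × ℕ)) : Prop :=
  IsHeap G E ∧ ∃ p : V × ℕ, minPieces G E = {p}

/-- The weight of `E`: the number of its pieces in each position. -/
def weight {V : Type*} [DecidableEq V] (E : Finset (V × ℕ)) (a : V) : ℕ :=
  (E.filter fun p => p.1 = a).card

/-- The set of pyramids of weight `k`. -/
def pyramids {V : Type*} [DecidableEq V] (G : SimpleGraph V) (k : V → ℕ) :
    Set (Finset (V × ℕ)) :=
  {E | IsPyramid G E ∧ weight E = k}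

/-- The set of pyramids of weight `k` with basis `a`. -/
def pyramidsWithBasis {V : Type*} [DecidableEq V] (G : SimpleGraph V) (k : V → ℕ) (a : V) :
    Set (Finset (V × ℕ)) :=
  {E | IsPyramidWithBasis G a E ∧ weight E = k}

/-- The height of `k`: the sum of its entries. -/
def height {V : Type*} [Fintype V] (k : V → ℕ) : ℕ :=
  ∑ a, k a

end HeapsOfPieces

namespace HeapsOfPieces

open Finset

/-! ### Order-preserving vertical moves, rigidity of heaps, and dropping pieces. -/

section Moves

variable {V : Type*} {G : SimpleGraph V}

/-! Marking a piece in position `a` of a heap splits the heap into the pyramid above that piece and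
the heap that remains; dropping the pyramid back on the remainder inverts this. With generating
functions `H` of heaps and `P_a` of pyramids with basis `a`, and `D_a = x_a ∂/∂x_a`, this reads `D_a
H = P_a H` (`mul_ncard_heaps`). So `P_a` is a logarithmic derivative of `H`, and since `D_a` and
`D_b` commute, `D_b P_a = D_a P_b` (`euler_eq_of_euler_eq_mul`). Its coefficients are claim 3;
division gives claim 2 and summation over bases claim 1.

That the splitting is a bijection rests on rigidity (`IsMove.eq_self`): each round trip is a move
from a heap to a heap, hence the identity. -/

theorem Concurrent.symm {a b : V} (h : Concurrent G a b) : Concurrent G b a :=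
  h.elim (fun h => Or.inl h.symm) (fun h => Or.inr h.symm)

theorem IsPreHeap.subset {S T : Finset (V × ℕ)} (hT : IsPreHeap G T) (h : S ⊆ T) :
    IsPreHeap G S :=
  fun p hp q hq => hT p (h hp) q (h hq)

theorem IsPreHeap.eq_or_lt {S : Finset (V × ℕ)} (hS : IsPreHeap G S) {p q : V × ℕ} (hp : p ∈ S)
    (hq : q ∈ S) (h : Concurrent G p.1 q.1) : p = q ∨ p.2 < q.2 ∨ q.2 < p.2 := by
  by_cases hpq : p = q
  · exact Or.inl hpq
  · exact Or.inr (lt_or_gt_of_ne (hS p hp q hq hpq h))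

/-- A vertical move of the pieces of `S` that keeps concurrent pieces in the same order. -/
structure IsMove (G : SimpleGraph V) (S : Finset (V × ℕ)) (φ : V × ℕ → V × ℕ) : Prop where
  pos : ∀ p ∈ S, (φ p).1 = p.1
  mono : ∀ p ∈ S, ∀ q ∈ S, Concurrent G p.1 q.1 → p.2 < q.2 → (φ p).2 < (φ q).2

namespace IsMove

variable {S T : Finset (V × ℕ)} {φ ψ : V × ℕ → V × ℕ}

theorem subset (h : IsMove G T φ) (hST : S ⊆ T) : IsMove G S φ :=
  ⟨fun p hp => h.pos p (hST hp), fun p hp q hq => h.mono p (hST hp) q (hST hq)⟩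

theorem comp_of_mapsTo (hψ : IsMove G T ψ) (hφ : IsMove G S φ) (hm : ∀ p ∈ S, φ p ∈ T) :
    IsMove G S (ψ ∘ φ) := by
  refine ⟨fun p hp => ?_, fun p hp q hq hc hlt => ?_⟩
  · rw [Function.comp_apply, hψ.pos _ (hm p hp), hφ.pos p hp]
  · refine hψ.mono _ (hm p hp) _ (hm q hq) ?_ (hφ.mono p hp q hq hc hlt)
    rwa [hφ.pos p hp, hφ.pos q hq]

theorem lt_of_lt (h : IsMove G S φ) (hS : IsPreHeap G S) {p q : V × ℕ} (hp : p ∈ S) (hq : q ∈ S)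
    (hc : Concurrent G p.1 q.1) (hlt : (φ p).2 < (φ q).2) : p.2 < q.2 := by
  rcases hS.eq_or_lt hp hq hc with rfl | h' | h'
  · exact absurd hlt (lt_irrefl _)
  · exact h'
  · exact absurd hlt (h.mono q hq p hp hc.symm h').asymm

theorem injOn (h : IsMove G S φ) (hS : IsPreHeap G S) : Set.InjOn φ S := by
  intro p hp q hq hpq
  have hc : p.1 = q.1 := by rw [← h.pos p hp, ← h.pos q hq, hpq]
  rcases hS.eq_or_lt hp hq (Or.inl hc) with h' | h' | h'
  · exact h'
  · exact absurd (h.mono p hp q hq (Or.inl hc) h') (by simp [hpq])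
  · exact absurd (h.mono q hq p hp (Or.inl hc.symm) h') (by simp [hpq])

theorem isPreHeap_image [DecidableEq V] (h : IsMove G S φ) (hS : IsPreHeap G S) :
    IsPreHeap G (S.image φ) := by
  intro p hp q hq hpq hc
  obtain ⟨x, hx, rfl⟩ := mem_image.1 hp
  obtain ⟨y, hy, rfl⟩ := mem_image.1 hq
  rw [h.pos x hx, h.pos y hy] at hc
  rcases hS.eq_or_lt hx hy hc with rfl | h' | h'
  · exact absurd rfl hpq
  · exact (h.mono x hx y hy hc h').ne
  · exact (h.mono y hy x hx hc.symm h').ne'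

theorem weight_image [DecidableEq V] (h : IsMove G S φ) (hS : IsPreHeap G S) :
    weight (S.image φ) = weight S := by
  funext a
  unfold weight
  rw [filter_image, card_image_of_injOn ((h.injOn hS).mono (coe_subset.2 (filter_subset _ _)))]
  congr 1
  refine filter_congr fun p hp => ?_
  rw [h.pos p hp]

theorem pieceLE (h : IsMove G S φ) (hm : ∀ p ∈ S, φ p ∈ T) {p q : V × ℕ}
    (hpq : PieceLE G S p q) : PieceLE G T (φ p) (φ q) := by
  refine Relation.ReflTransGen.lift φ ?_ _ _ hpq
  rintro x y ⟨hx, hy, hc, hlt⟩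
  refine ⟨hm x hx, hm y hy, ?_, h.mono x hx y hy hc hlt⟩
  rwa [h.pos x hx, h.pos y hy]

/-- Heaps are rigid: no move turns a heap into a different heap. -/
theorem eq_self [DecidableEq V] (h : IsMove G S φ) (hS : IsHeap G S)
    (hφ : IsHeap G (S.image φ)) : ∀ p ∈ S, φ p = p := by
  -- Supports in `S` keep `φ` from lowering a piece; supports in the image, pulled back because
  -- moves reflect the order, keep it from raising one.
  have le1 : ∀ n : ℕ, ∀ p ∈ S, p.2 = n → n ≤ (φ p).2 := by
    intro n
    induction n with
    | zero => intros; exact Nat.zero_le _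
    | succ n ih =>
      intro p hp hn
      obtain ⟨q, hq, hqp, hc⟩ := hS.2 p hp (by omega)
      have h1 := ih q hq (by omega)
      have h2 := h.mono q hq p hp hc.symm (by omega)
      omega
  have le2 : ∀ n : ℕ, ∀ p ∈ S, (φ p).2 = n → n ≤ p.2 := by
    intro n
    induction n with
    | zero => intros; exact Nat.zero_le _
    | succ n ih =>
      intro p hp hn
      obtain ⟨q', hq', hqp, hc⟩ := hφ.2 (φ p) (mem_image_of_mem _ hp) (by omega)
      obtain ⟨q, hq, rfl⟩ := mem_image.1 hq'
      rw [h.pos p hp, h.pos q hq] at hc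
      have h1 := ih q hq (by omega)
      have h2 := h.lt_of_lt hS.1 hq hp hc.symm (by omega)
      omega
  intro p hp
  exact Prod.ext (h.pos p hp) (le_antisymm (le2 _ p hp rfl) (le1 _ p hp rfl))

end IsMove

open Classical in
/-- The level at which a piece comes to rest when the pieces of `S` are dropped. -/
noncomputable def rank (G : SimpleGraph V) (S : Finset (V × ℕ)) (p : V × ℕ) : ℕ :=
  -- The empty supremum is 0: a piece with nothing beneath it falls to the floor.
  (S.filter fun q => Concurrent G p.1 q.1 ∧ q.2 < p.2).attach.sup fun q => rank G S q.1 + 1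
termination_by p.2
decreasing_by exact (mem_filter.1 q.2).2.2

theorem rank_lt_rank {S : Finset (V × ℕ)} {p q : V × ℕ} (hp : p ∈ S) (hc : Concurrent G p.1 q.1)
    (hlt : p.2 < q.2) : rank G S p < rank G S q := by
  classical
  rw [rank.eq_1 G S q]
  exact Nat.lt_of_succ_le (Finset.le_sup
    (f := fun x : {x // x ∈ S.filter fun p => Concurrent G q.1 p.1 ∧ p.2 < q.2} =>
      rank G S x.1 + 1) (mem_attach _ ⟨p, mem_filter.2 ⟨hp, hc.symm, hlt⟩⟩))

theorem exists_rank_add_one_eq {S : Finset (V × ℕ)} {p : V × ℕ} (h : 0 < rank G S p) :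
    ∃ q ∈ S, Concurrent G p.1 q.1 ∧ q.2 < p.2 ∧ rank G S q + 1 = rank G S p := by
  classical
  rw [rank.eq_1 G S p] at h ⊢
  obtain ⟨x, -, hx⟩ := Finset.lt_sup_iff.1 h
  obtain ⟨y, -, hy⟩ := Finset.exists_mem_eq_sup
    (S.filter fun q => Concurrent G p.1 q.1 ∧ q.2 < p.2).attach ⟨x, mem_attach _ _⟩
    fun q => rank G S q.1 + 1
  have hm := mem_filter.1 y.2
  exact ⟨y.1, hm.1, hm.2.1, hm.2.2, hy.symm⟩

/-- The move that drops the pieces of `S`. -/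
noncomputable def settle (G : SimpleGraph V) (S : Finset (V × ℕ)) (p : V × ℕ) : V × ℕ :=
  (p.1, rank G S p)

theorem isMove_settle (S : Finset (V × ℕ)) : IsMove G S (settle G S) :=
  ⟨fun _ _ => rfl, fun _ hp _ _ hc hlt => rank_lt_rank hp hc hlt⟩

variable [DecidableEq V]

/-- The heap obtained by dropping the pieces of `S`. -/
noncomputable def drop (G : SimpleGraph V) (S : Finset (V × ℕ)) : Finset (V × ℕ) :=
  S.image (settle G S)

theorem settle_mem_drop {S : Finset (V × ℕ)} {p : V × ℕ} (hp : p ∈ S) : settle G S p ∈ drop G S :=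
  mem_image_of_mem _ hp

/-- A piece of positive rank has a support one rank lower, which a down-closed `S` contains.
Allowing `S ≠ T` serves the bottom part of a stack. -/
theorem isHeap_image_settle {S T : Finset (V × ℕ)} (hT : IsPreHeap G T) (hST : S ⊆ T)
    (hdown : ∀ p ∈ S, ∀ q ∈ T, Concurrent G p.1 q.1 → q.2 < p.2 → q ∈ S) :
    IsHeap G (S.image (settle G T)) := by
  refine ⟨((isMove_settle T).subset hST).isPreHeap_image (hT.subset hST), fun p hp hpos => ?_⟩
  obtain ⟨x, hx, rfl⟩ := mem_image.1 hp
  obtain ⟨y, hy, hc, hlt, hr⟩ := exists_rank_add_one_eq hpos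
  exact ⟨_, mem_image_of_mem _ (hdown x hx y hy hc hlt), hr, hc⟩

theorem isHeap_drop {S : Finset (V × ℕ)} (hS : IsPreHeap G S) : IsHeap G (drop G S) :=
  isHeap_image_settle hS Subset.rfl fun _ _ _ hq _ _ => hq

theorem weight_drop {S : Finset (V × ℕ)} (hS : IsPreHeap G S) : weight (drop G S) = weight S :=
  (isMove_settle S).weight_image hS

theorem weight_union {S T : Finset (V × ℕ)} (h : Disjoint S T) :
    weight (S ∪ T) = weight S + weight T := by
  funext a
  simp only [weight, Pi.add_apply, filter_union]
  exact card_union_of_disjoint (disjoint_filter_filter h)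

end Moves

/-! ### Splitting a heap at a piece, and superposing a pyramid on a heap. -/

section Pyramids

variable {V : Type*} {G : SimpleGraph V}

theorem PieceLE.eq_or_lt {E : Finset (V × ℕ)} {p q : V × ℕ} (h : PieceLE G E p q) :
    p = q ∨ p.2 < q.2 := by
  induction h with
  | refl => exact Or.inl rfl
  | tail _ hb ih =>
    obtain ⟨-, -, -, hlt⟩ := hb
    rcases ih with rfl | h
    · exact Or.inr hlt
    · exact Or.inr (h.trans hlt)

theorem IsHeap.exists_pieceLE_of_le {E : Finset (V × ℕ)} (hE : IsHeap G E) :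
    ∀ (n : ℕ) (p : V × ℕ), p ∈ E → n ≤ p.2 → ∃ q ∈ E, q.2 + n = p.2 ∧ PieceLE G E q p := by
  intro n
  induction n with
  | zero => exact fun p hp _ => ⟨p, hp, rfl, Relation.ReflTransGen.refl⟩
  | succ n ih =>
    intro p hp hn
    obtain ⟨q, hq, hqp, hle⟩ := ih p hp (by omega)
    obtain ⟨r, hr, hrq, hc⟩ := hE.2 q hq (by omega)
    exact ⟨r, hr, by omega, Relation.ReflTransGen.head ⟨hr, hq, hc.symm, by omega⟩ hle⟩

theorem IsHeap.minPieces_eq {E : Finset (V × ℕ)} (hE : IsHeap G E) :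
    minPieces G E = {p | p ∈ E ∧ p.2 = 0} := by
  ext p
  refine and_congr_right fun hp => ⟨fun h => ?_, fun h q _ hqp => ?_⟩
  · by_contra hne
    obtain ⟨q, hq, hqp, hc⟩ := hE.2 p hp (by omega)
    have := h q hq (Relation.ReflTransGen.single ⟨hq, hp, hc.symm, by omega⟩)
    subst this
    omega
  · exact hqp.eq_or_lt.resolve_right (by omega)

/-- The supports below a piece occupy every lower level. This bounds levels by the weight, whence
finiteness. -/
theorem IsHeap.lt_card {G : SimpleGraph V} {E : Finset (V × ℕ)} (hE : IsHeap G E) {p : V × ℕ}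
    (hp : p ∈ E) : p.2 < E.card := by
  have hsub : range (p.2 + 1) ⊆ E.image Prod.snd := by
    intro n hn
    have hn := mem_range.1 hn
    obtain ⟨q, hq, hqp, -⟩ := hE.exists_pieceLE_of_le (p.2 - n) p hp (by omega)
    exact mem_image.2 ⟨q, hq, by omega⟩
  have := (card_le_card hsub).trans card_image_le
  rwa [card_range] at this

/-- Minimal pieces of a heap are those on the floor, and every piece descends to one. Unlike
minimality, the resulting condition is transported by moves. -/
theorem isPyramidWithBasis_iff {a : V} {E : Finset (V × ℕ)} :
    IsPyramidWithBasis G a E ↔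
      IsHeap G E ∧ (a, 0) ∈ E ∧ ∀ p ∈ E, PieceLE G E (a, 0) p := by
  constructor
  · rintro ⟨hE, l, hl⟩
    rw [hE.minPieces_eq] at hl
    have hm : (a, l) ∈ {p | p ∈ E ∧ p.2 = 0} := by rw [hl]; rfl
    obtain ⟨hm, rfl : l = 0⟩ := hm
    refine ⟨hE, hm, fun p hp => ?_⟩
    obtain ⟨q, hq, hqp, hle⟩ := hE.exists_pieceLE_of_le p.2 p hp le_rfl
    have : q ∈ ({(a, 0)} : Set (V × ℕ)) := by rw [← hl]; exact ⟨hq, by omega⟩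
    rwa [← Set.mem_singleton_iff.1 this]
  · rintro ⟨hE, ha, h⟩
    refine ⟨hE, 0, ?_⟩
    rw [hE.minPieces_eq]
    ext p
    refine ⟨fun hp => ?_, fun hp => ?_⟩
    · exact ((h p hp.1).eq_or_lt.resolve_right (by have := hp.2; omega)).symm
    · rw [Set.mem_singleton_iff.1 hp]
      exact ⟨ha, rfl⟩

open Classical in
/-- The pieces of `E` that lie above `p`. -/
noncomputable def upper (G : SimpleGraph V) (E : Finset (V × ℕ)) (p : V × ℕ) : Finset (V × ℕ) :=
  E.filter (PieceLE G E p)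

theorem mem_upper {E : Finset (V × ℕ)} {p q : V × ℕ} :
    q ∈ upper G E p ↔ q ∈ E ∧ PieceLE G E p q := by
  classical
  exact mem_filter

theorem upper_subset (E : Finset (V × ℕ)) (p : V × ℕ) : upper G E p ⊆ E :=
  fun _ hq => (mem_upper.1 hq).1

theorem self_mem_upper {E : Finset (V × ℕ)} {p : V × ℕ} (hp : p ∈ E) : p ∈ upper G E p :=
  mem_upper.2 ⟨hp, Relation.ReflTransGen.refl⟩

theorem mem_upper_of_lt {E : Finset (V × ℕ)} {p q r : V × ℕ} (hq : q ∈ upper G E p) (hr : r ∈ E)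
    (hc : Concurrent G q.1 r.1) (hlt : q.2 < r.2) : r ∈ upper G E p := by
  obtain ⟨hqE, hpq⟩ := mem_upper.1 hq
  exact mem_upper.2 ⟨hr, hpq.tail ⟨hqE, hr, hc, hlt⟩⟩

theorem pieceLE_upper {E : Finset (V × ℕ)} {p q : V × ℕ} (h : PieceLE G E p q) :
    PieceLE G (upper G E p) p q := by
  induction h with
  | refl => exact Relation.ReflTransGen.refl
  | @tail b c hpb hb ih =>
    have hbU : b ∈ upper G E p := mem_upper.2 ⟨hb.1, hpb⟩
    exact ih.tail ⟨hbU, mem_upper_of_lt hbU hb.2.1 hb.2.2.1 hb.2.2.2, hb.2.2⟩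

theorem settle_upper_self {E : Finset (V × ℕ)} {p : V × ℕ} :
    settle G (upper G E p) p = (p.1, 0) := by
  refine Prod.ext rfl (Nat.eq_zero_of_not_pos fun h => ?_)
  obtain ⟨q, hq, hc, hlt, -⟩ := exists_rank_add_one_eq h
  rcases (mem_upper.1 hq).2.eq_or_lt with rfl | h'
  · exact lt_irrefl _ hlt
  · exact lt_asymm hlt h'

/-- Raising a piece by `N` levels. -/
def lift (N : ℕ) (p : V × ℕ) : V × ℕ := (p.1, p.2 + N)

theorem isMove_lift (N : ℕ) (S : Finset (V × ℕ)) : IsMove G S (lift N) :=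
  ⟨fun _ _ => rfl, fun _ _ _ _ _ h => Nat.add_lt_add_right h N⟩

/-- A level above all pieces of `F`. -/
def top (F : Finset (V × ℕ)) : ℕ := F.sup Prod.snd + 1

theorem lt_top {F : Finset (V × ℕ)} {p : V × ℕ} (hp : p ∈ F) : p.2 < top F :=
  Nat.lt_succ_of_le (Finset.le_sup (f := Prod.snd) hp)

theorem lift_notMem (F : Finset (V × ℕ)) (p : V × ℕ) : lift (top F) p ∉ F :=
  fun h => absurd (lt_top h) (by simp [lift])

theorem lt_lift {F : Finset (V × ℕ)} {p : V × ℕ} (hp : p ∈ F) (q : V × ℕ) :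
    p.2 < (lift (top F) q).2 :=
  (lt_top hp).trans_le (Nat.le_add_left _ _)

variable [DecidableEq V]

theorem isPyramidWithBasis_drop_upper {E : Finset (V × ℕ)} (hE : IsHeap G E) {p : V × ℕ}
    (hp : p ∈ E) : IsPyramidWithBasis G p.1 (drop G (upper G E p)) := by
  rw [isPyramidWithBasis_iff, ← settle_upper_self (E := E)]
  refine ⟨isHeap_drop (hE.1.subset (upper_subset E p)), settle_mem_drop (self_mem_upper hp),
    fun q hq => ?_⟩
  obtain ⟨x, hx, rfl⟩ := mem_image.1 hq
  exact (isMove_settle _).pieceLE (fun _ => settle_mem_drop)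
    (pieceLE_upper (mem_upper.1 hx).2)

theorem isHeap_sdiff_upper {E : Finset (V × ℕ)} (hE : IsHeap G E) (p : V × ℕ) :
    IsHeap G (E \ upper G E p) := by
  refine ⟨hE.1.subset sdiff_subset, fun q hq hpos => ?_⟩
  obtain ⟨hqE, hqU⟩ := mem_sdiff.1 hq
  obtain ⟨r, hr, hrq, hc⟩ := hE.2 q hqE hpos
  exact ⟨r, mem_sdiff.2 ⟨hr, fun h => hqU (mem_upper_of_lt h hqE hc.symm (by omega))⟩, hrq, hc⟩

theorem weight_drop_upper_add {E : Finset (V × ℕ)} (hE : IsHeap G E) (p : V × ℕ) :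
    weight (drop G (upper G E p)) + weight (E \ upper G E p) = weight E := by
  rw [weight_drop (hE.1.subset (upper_subset E p)), ← weight_union disjoint_sdiff,
    union_sdiff_of_subset (upper_subset E p)]

/-- The pieces of `F` with those of `P` high above them. -/
def stack (F P : Finset (V × ℕ)) : Finset (V × ℕ) := F ∪ P.image (lift (top F))

theorem mem_stack_left {F P : Finset (V × ℕ)} {p : V × ℕ} (hp : p ∈ F) : p ∈ stack F P :=
  mem_union_left _ hp

theorem lift_mem_stack {F P : Finset (V × ℕ)} {p : V × ℕ} (hp : p ∈ P) :
    lift (top F) p ∈ stack F P :=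
  mem_union_right _ (mem_image_of_mem _ hp)

theorem mem_of_mem_stack_of_lt {F P : Finset (V × ℕ)} {p : V × ℕ} (hp : p ∈ stack F P)
    (h : p.2 < top F) : p ∈ F := by
  refine (mem_union.1 hp).resolve_right fun hp' => ?_
  obtain ⟨x, -, rfl⟩ := mem_image.1 hp'
  exact absurd h (by simp [lift])

theorem isPreHeap_stack {F P : Finset (V × ℕ)} (hF : IsPreHeap G F) (hP : IsPreHeap G P) :
    IsPreHeap G (stack F P) := by
  intro p hp q hq hpq hc
  rcases mem_union.1 hp with hp | hp <;> rcases mem_union.1 hq with hq | hq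
  · exact hF p hp q hq hpq hc
  · obtain ⟨y, -, rfl⟩ := mem_image.1 hq
    exact (lt_lift hp y).ne
  · obtain ⟨y, -, rfl⟩ := mem_image.1 hp
    exact (lt_lift hq y).ne'
  · exact (isMove_lift _ P).isPreHeap_image hP p hp q hq hpq hc

theorem weight_stack {F P : Finset (V × ℕ)} (hP : IsPreHeap G P) :
    weight (stack F P) = weight F + weight P := by
  rw [← (isMove_lift (top F) P).weight_image hP]
  refine weight_union (disjoint_left.2 fun p hp hp' => ?_)
  obtain ⟨x, -, rfl⟩ := mem_image.1 hp'
  exact lift_notMem F x hp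

/-- The heap obtained by dropping `P` on top of `F`. -/
noncomputable def superpose (G : SimpleGraph V) (F P : Finset (V × ℕ)) : Finset (V × ℕ) :=
  drop G (stack F P)

/-- The place of a piece of `P` when `P` is dropped on top of `F`. -/
noncomputable def place (G : SimpleGraph V) (F P : Finset (V × ℕ)) (p : V × ℕ) : V × ℕ :=
  settle G (stack F P) (lift (top F) p)

theorem isMove_place (F P : Finset (V × ℕ)) : IsMove G P (place G F P) :=
  (isMove_settle _).comp_of_mapsTo (isMove_lift _ P) fun _ => lift_mem_stack

theorem place_mem_superpose {F P : Finset (V × ℕ)} {p : V × ℕ} (hp : p ∈ P) :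
    place G F P p ∈ superpose G F P :=
  settle_mem_drop (lift_mem_stack hp)

theorem superpose_sdiff_upper {E : Finset (V × ℕ)} (hE : IsHeap G E) {p : V × ℕ} (hp : p ∈ E) :
    superpose G (E \ upper G E p) (drop G (upper G E p)) = E ∧
      place G (E \ upper G E p) (drop G (upper G E p)) (p.1, 0) = p := by
  classical
  set U := upper G E p
  set F := E \ U
  set P := drop G U
  have hUE : U ⊆ E := upper_subset E p
  -- `φ` carries `E` onto the stack. It is a move because `U` is up-closed, so no piece of `U` has
  -- to stay below one of `F`; rigidity then applies to `φ` followed by settling.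
  let φ : V × ℕ → V × ℕ := fun q => if q ∈ U then lift (top F) (settle G U q) else q
  have hφU : ∀ q ∈ U, φ q = lift (top F) (settle G U q) := fun q hq => if_pos hq
  have hφF : ∀ q ∉ U, φ q = q := fun q hq => if_neg hq
  have hm : ∀ q ∈ E, φ q ∈ stack F P := by
    intro q hq
    by_cases h : q ∈ U
    · rw [hφU q h]; exact lift_mem_stack (settle_mem_drop h)
    · rw [hφF q h]; exact mem_stack_left (mem_sdiff.2 ⟨hq, h⟩)
  have hφ : IsMove G E φ := by
    refine ⟨fun q _ => ?_, fun q hq r hr hc hlt => ?_⟩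
    · by_cases h : q ∈ U
      · rw [hφU q h]; rfl
      · rw [hφF q h]
    · by_cases h : q ∈ U
      · have h' : r ∈ U := mem_upper_of_lt h hr hc hlt
        rw [hφU q h, hφU r h']
        exact Nat.add_lt_add_right (rank_lt_rank h hc hlt) _
      · rw [hφF q h]
        by_cases h' : r ∈ U
        · rw [hφU r h']; exact lt_lift (mem_sdiff.2 ⟨hq, h⟩) _
        · rwa [hφF r h']
  have himage : E.image (settle G (stack F P) ∘ φ) = superpose G F P := by
    rw [← image_image, superpose, drop]
    congr 1
    refine Subset.antisymm (image_subset_iff.2 hm) (union_subset (fun q hq => ?_) ?_)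
    · exact mem_image.2 ⟨q, (mem_sdiff.1 hq).1, hφF q (mem_sdiff.1 hq).2⟩
    · intro q hq
      obtain ⟨x, hx, rfl⟩ := mem_image.1 hq
      obtain ⟨y, hy, rfl⟩ := mem_image.1 hx
      exact mem_image.2 ⟨y, hUE hy, hφU y hy⟩
  have hfix := ((isMove_settle _).comp_of_mapsTo hφ hm).eq_self hE (by
    rw [himage]
    exact isHeap_drop (isPreHeap_stack (hE.1.subset sdiff_subset)
      (isHeap_drop (hE.1.subset hUE)).1))
  constructor
  · rw [← himage]
    exact (image_congr hfix).trans image_id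
  · have h1 := hfix p hp
    rwa [Function.comp_apply, hφU p (self_mem_upper hp), settle_upper_self] at h1

/-- `F` is down-closed in the stack, so it settles to a heap, and rigidity keeps it in place. -/
theorem settle_stack_left {F P : Finset (V × ℕ)} (hF : IsHeap G F) (hP : IsPreHeap G P) :
    ∀ p ∈ F, settle G (stack F P) p = p :=
  ((isMove_settle _).subset subset_union_left).eq_self hF
    (isHeap_image_settle (isPreHeap_stack hF.1 hP) subset_union_left
      fun _ hp _ hq _ hlt => mem_of_mem_stack_of_lt hq (hlt.trans (lt_top hp)))

theorem superpose_eq_union {F P : Finset (V × ℕ)} (hF : IsHeap G F) (hP : IsPreHeap G P) :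
    superpose G F P = F ∪ P.image (place G F P) := by
  rw [superpose, drop]
  conv_lhs => arg 2; rw [stack]
  rw [image_union, image_image]
  congr 1
  exact (image_congr (settle_stack_left hF hP)).trans image_id

theorem place_notMem {F P : Finset (V × ℕ)} (hF : IsHeap G F) (hP : IsPreHeap G P) {p : V × ℕ}
    (hp : p ∈ P) : place G F P p ∉ F := by
  intro h
  have h1 := settle_stack_left hF hP _ h
  have h2 := (isMove_settle _).injOn (isPreHeap_stack hF.1 hP) (mem_stack_left h)
    (lift_mem_stack hp) h1
  exact lift_notMem F p (h2 ▸ h)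

theorem upper_superpose {F P : Finset (V × ℕ)} {a : V} (hF : IsHeap G F)
    (hP : IsPyramidWithBasis G a P) :
    upper G (superpose G F P) (place G F P (a, 0)) = P.image (place G F P) := by
  obtain ⟨hPh, ha, hle⟩ := isPyramidWithBasis_iff.1 hP
  refine Subset.antisymm (fun q hq => ?_) (fun q hq => ?_)
  · have hle' := (mem_upper.1 hq).2
    clear hq
    induction hle' with
    | refl => exact mem_image_of_mem _ ha
    | @tail b c _ hb ih =>
      have hb' := ih
      obtain ⟨-, hc, hcon, hlt⟩ := hb
      rw [superpose_eq_union hF hPh.1] at hc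
      refine (mem_union.1 hc).resolve_left fun hcF => ?_
      obtain ⟨x, hx, rfl⟩ := mem_image.1 hb'
      rw [← settle_stack_left hF hPh.1 c hcF] at hlt
      -- Settling reflects the order, so a piece of `F` above a piece of `P` would already be so in
      -- the stack.
      have := (isMove_settle (G := G) (stack F P)).lt_of_lt (isPreHeap_stack hF.1 hPh.1)
        (lift_mem_stack hx) (mem_stack_left hcF) hcon hlt
      exact lt_asymm this (lt_lift hcF x)
  · obtain ⟨x, hx, rfl⟩ := mem_image.1 hq
    exact mem_upper.2 ⟨place_mem_superpose hx,
      (isMove_place F P).pieceLE (fun _ => place_mem_superpose) (hle x hx)⟩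

theorem superpose_sdiff_upper_place {F P : Finset (V × ℕ)} {a : V} (hF : IsHeap G F)
    (hP : IsPyramidWithBasis G a P) :
    superpose G F P \ upper G (superpose G F P) (place G F P (a, 0)) = F := by
  rw [upper_superpose hF hP, superpose_eq_union hF hP.1.1]
  refine union_sdiff_cancel_right (disjoint_left.2 fun p hp hp' => ?_)
  obtain ⟨x, hx, rfl⟩ := mem_image.1 hp'
  exact place_notMem hF hP.1.1 hx hp

theorem drop_upper_superpose {F P : Finset (V × ℕ)} {a : V} (hF : IsHeap G F)
    (hP : IsPyramidWithBasis G a P) :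
    drop G (upper G (superpose G F P) (place G F P (a, 0))) = P := by
  rw [upper_superpose hF hP]
  have himage : P.image (settle G (P.image (place G F P)) ∘ place G F P) =
      drop G (P.image (place G F P)) := by
    rw [drop, image_image]
  rw [← himage]
  refine (image_congr (IsMove.eq_self ((isMove_settle _).comp_of_mapsTo (isMove_place F P)
    fun _ => mem_image_of_mem _) hP.1 ?_)).trans image_id
  rw [himage]
  exact isHeap_drop ((isMove_place F P).isPreHeap_image hP.1.1)

end Pyramids

/-! ### Finiteness and the count of marked heaps. -/

section Counting

variable {V : Type*} [DecidableEq V]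

/-- The set of heaps of weight `k`. -/
def heaps (G : SimpleGraph V) (k : V → ℕ) : Set (Finset (V × ℕ)) :=
  {E | IsHeap G E ∧ weight E = k}

variable [Fintype V]

theorem card_eq_height (E : Finset (V × ℕ)) : E.card = height (weight E) :=
  card_eq_sum_card_fiberwise fun _ _ => mem_coe.2 (mem_univ _)

variable (G : SimpleGraph V)

theorem finite_heaps (k : V → ℕ) : (heaps G k).Finite := by
  refine (univ ×ˢ range (height k) : Finset (V × ℕ)).powerset.finite_toSet.subset ?_
  rintro E ⟨hE, rfl⟩
  refine mem_coe.2 (mem_powerset.2 fun p hp => ?_)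
  rw [mem_product, mem_range, ← card_eq_height]
  exact ⟨mem_univ _, hE.lt_card hp⟩

theorem finite_pyramids (k : V → ℕ) : (pyramids G k).Finite :=
  (finite_heaps G k).subset fun _ h => ⟨h.1.1, h.2⟩

theorem finite_pyramidsWithBasis (k : V → ℕ) (a : V) : (pyramidsWithBasis G k a).Finite :=
  (finite_heaps G k).subset fun _ h => ⟨h.1.1, h.2⟩

theorem ncard_pyramids (k : V → ℕ) :
    (pyramids G k).ncard = ∑ a, (pyramidsWithBasis G k a).ncard := by
  classical
  have hU : (finite_pyramids G k).toFinset =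
      univ.biUnion fun a => (finite_pyramidsWithBasis G k a).toFinset := by
    ext E
    simp only [Set.Finite.mem_toFinset, mem_biUnion, mem_univ, true_and]
    constructor
    · rintro ⟨⟨hE, ⟨a, l⟩, h⟩, hw⟩
      exact ⟨a, ⟨hE, l, h⟩, hw⟩
    · rintro ⟨a, ⟨hE, l, h⟩, hw⟩
      exact ⟨⟨hE, (a, l), h⟩, hw⟩
  rw [Set.ncard_eq_toFinset_card _ (finite_pyramids G k), hU, card_biUnion]
  · exact sum_congr rfl fun a _ => (Set.ncard_eq_toFinset_card _ _).symm
  · intro a _ b _ hab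
    refine disjoint_left.2 fun E ha hb => hab ?_
    obtain ⟨⟨-, l, hl⟩, -⟩ := (Set.Finite.mem_toFinset _).1 ha
    obtain ⟨⟨-, m, hm⟩, -⟩ := (Set.Finite.mem_toFinset _).1 hb
    exact congrArg Prod.fst (Set.singleton_injective (hl.symm.trans hm))

/-- Marking a piece in position `a` of a heap amounts to splitting off the pyramid above it. -/
theorem mul_ncard_heaps (k : V →₀ ℕ) (a : V) :
    k a * (heaps G k).ncard =
      ∑ x ∈ antidiagonal k, (pyramidsWithBasis G x.1 a).ncard * (heaps G x.2).ncard := by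
  classical
  -- `A` holds the heaps with a marked piece in position `a`, `B` the pairs (pyramid, remaining
  -- heap).
  let A : Finset (Finset (V × ℕ) × (V × ℕ)) :=
    (finite_heaps G k).toFinset.biUnion fun E => {E} ×ˢ E.filter fun p => p.1 = a
  let B : Finset (Finset (V × ℕ) × Finset (V × ℕ)) :=
    (antidiagonal k).biUnion fun x =>
      (finite_pyramidsWithBasis G x.1 a).toFinset ×ˢ (finite_heaps G x.2).toFinset
  have memA : ∀ x, x ∈ A ↔ (IsHeap G x.1 ∧ weight x.1 = k) ∧ x.2 ∈ x.1 ∧ x.2.1 = a := by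
    rintro ⟨E, p⟩
    simp only [A, mem_biUnion, Set.Finite.mem_toFinset, mem_product, mem_singleton, mem_filter]
    constructor
    · rintro ⟨E', hE', rfl, h⟩; exact ⟨hE', h⟩
    · rintro ⟨hE, h⟩; exact ⟨E, hE, rfl, h⟩
  have memB : ∀ x, x ∈ B ↔
      IsPyramidWithBasis G a x.1 ∧ IsHeap G x.2 ∧ weight x.1 + weight x.2 = k := by
    rintro ⟨P, F⟩
    simp only [B, mem_biUnion, Set.Finite.mem_toFinset, mem_product, HasAntidiagonal.mem_antidiagonal]
    constructor
    · rintro ⟨⟨u, v⟩, rfl, ⟨hP, hu⟩, hF, hv⟩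
      refine ⟨hP, hF, ?_⟩
      rw [hu, hv]; rfl
    · rintro ⟨hP, hF, hw⟩
      refine ⟨(Finsupp.equivFunOnFinite.symm (weight P), Finsupp.equivFunOnFinite.symm (weight F)),
        ?_, ⟨hP, rfl⟩, hF, rfl⟩
      exact DFunLike.coe_injective (F := V →₀ ℕ) hw
  have cardA : A.card = k a * (heaps G k).ncard := by
    rw [card_biUnion]
    · rw [Set.ncard_eq_toFinset_card _ (finite_heaps G k), mul_comm, ← smul_eq_mul]
      refine sum_const_nat fun E hE => ?_
      rw [card_product, card_singleton, one_mul, ← ((Set.Finite.mem_toFinset _).1 hE).2]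
      rfl
    · intro E _ E' _ hne
      exact disjoint_product.2 (Or.inl (by simpa using hne))
  have cardB : B.card =
      ∑ x ∈ antidiagonal k, (pyramidsWithBasis G x.1 a).ncard * (heaps G x.2).ncard := by
    rw [card_biUnion]
    · refine sum_congr rfl fun x _ => ?_
      rw [card_product, Set.ncard_eq_toFinset_card _ (finite_pyramidsWithBasis G x.1 a),
        Set.ncard_eq_toFinset_card _ (finite_heaps G x.2)]
    · intro x _ y _ hne
      refine disjoint_left.2 fun z hz hz' => hne ?_
      simp only [Set.Finite.mem_toFinset, mem_product] at hz hz'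
      exact Prod.ext (DFunLike.coe_injective (hz.1.2.symm.trans hz'.1.2))
        (DFunLike.coe_injective (hz.2.2.symm.trans hz'.2.2))
  rw [← cardA, ← cardB]
  refine card_nbij' (fun x => (drop G (upper G x.1 x.2), x.1 \ upper G x.1 x.2))
    (fun y => (superpose G y.2 y.1, place G y.2 y.1 (a, 0))) ?_ ?_ ?_ ?_
  · intro x hx
    obtain ⟨⟨hE, hw⟩, hp, rfl⟩ := (memA x).1 hx
    exact (memB _).2 ⟨isPyramidWithBasis_drop_upper hE hp, isHeap_sdiff_upper hE _,
      (weight_drop_upper_add hE _).trans hw⟩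
  · intro y hy
    obtain ⟨hP, hF, hw⟩ := (memB y).1 hy
    have hs := isPreHeap_stack hF.1 hP.1.1
    refine (memA _).2 ⟨⟨isHeap_drop hs, ?_⟩,
      place_mem_superpose (isPyramidWithBasis_iff.1 hP).2.1, rfl⟩
    exact (weight_drop hs).trans (((weight_stack hP.1.1).trans (add_comm _ _)).trans hw)
  · intro x hx
    obtain ⟨⟨hE, hw⟩, hp, rfl⟩ := (memA x).1 hx
    exact Prod.ext (superpose_sdiff_upper hE hp).1 (superpose_sdiff_upper hE hp).2
  · intro y hy
    obtain ⟨hP, hF, hw⟩ := (memB y).1 hy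
    exact Prod.ext (drop_upper_superpose hF hP) (superpose_sdiff_upper_place hF hP)

theorem heaps_zero : heaps G (0 : V → ℕ) = {∅} := by
  ext E
  constructor
  · rintro ⟨-, hw⟩
    have := card_eq_height E
    rw [hw] at this
    exact card_eq_zero.1 (this.trans (by simp [height]))
  · rintro rfl
    exact ⟨⟨by simp [IsPreHeap], by simp⟩, by funext a; simp [weight]⟩

end Counting

/-! ### Generating functions and logarithmic derivatives. -/

section Series

variable {V : Type*}

/-- The operator that multiplies the coefficient of `x ^ k` by `k a`. -/
def euler (a : V) (f : MvPowerSeries V ℤ) : MvPowerSeries V ℤ :=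
  fun k => k a * MvPowerSeries.coeff k f

theorem coeff_euler (a : V) (f : MvPowerSeries V ℤ) (k : V →₀ ℕ) :
    MvPowerSeries.coeff k (euler a f) = k a * MvPowerSeries.coeff k f :=
  rfl

theorem euler_mul (a : V) (f g : MvPowerSeries V ℤ) :
    euler a (f * g) = euler a f * g + f * euler a g := by
  classical
  ext k
  rw [map_add, coeff_euler, MvPowerSeries.coeff_mul, MvPowerSeries.coeff_mul,
    MvPowerSeries.coeff_mul, mul_sum, ← sum_add_distrib]
  refine sum_congr rfl fun x hx => ?_
  rw [← HasAntidiagonal.mem_antidiagonal.1 hx, coeff_euler, coeff_euler, Finsupp.add_apply]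
  push_cast
  ring

theorem euler_comm (a b : V) (f : MvPowerSeries V ℤ) :
    euler a (euler b f) = euler b (euler a f) := by
  ext k
  simp only [coeff_euler]
  ring

/-- Logarithmic derivatives satisfy the integrability condition. -/
theorem euler_eq_of_euler_eq_mul {a b : V} {f g h : MvPowerSeries V ℤ} (hf : f ≠ 0)
    (hg : euler a f = g * f) (hh : euler b f = h * f) : euler b g = euler a h := by
  -- By the Leibniz rule both sides contain `g * h * f`; it cancels, and then so does `f`.
  have key := euler_comm a b f
  rw [hg, hh, euler_mul, euler_mul, hg, hh] at key
  refine mul_right_cancel₀ hf ?_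
  linear_combination -key

variable [DecidableEq V] (G : SimpleGraph V)

/-- The generating function of heaps. -/
noncomputable def heapSeries : MvPowerSeries V ℤ := fun k => ((heaps G k).ncard : ℤ)

/-- The generating function of pyramids with basis `a`. -/
noncomputable def pyramidSeries (a : V) : MvPowerSeries V ℤ :=
  fun k => ((pyramidsWithBasis G k a).ncard : ℤ)

theorem coeff_heapSeries (k : V →₀ ℕ) :
    MvPowerSeries.coeff k (heapSeries G) = ((heaps G k).ncard : ℤ) :=
  rfl

theorem coeff_pyramidSeries (a : V) (k : V →₀ ℕ) :
    MvPowerSeries.coeff k (pyramidSeries G a) = ((pyramidsWithBasis G k a).ncard : ℤ) :=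
  rfl

variable [Fintype V]

theorem heapSeries_ne_zero : heapSeries G ≠ 0 := by
  intro h
  have h0 := congrArg (MvPowerSeries.coeff 0) h
  rw [coeff_heapSeries, Finsupp.coe_zero, heaps_zero, Set.ncard_singleton, map_zero] at h0
  exact one_ne_zero (Nat.cast_injective h0)

theorem euler_heapSeries (a : V) : euler a (heapSeries G) = pyramidSeries G a * heapSeries G := by
  ext k
  rw [coeff_euler, MvPowerSeries.coeff_mul]
  simp only [coeff_heapSeries, coeff_pyramidSeries]
  exact_mod_cast mul_ncard_heaps G k a

theorem mul_ncard_pyramidsWithBasis (k : V → ℕ) (i j : V) :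
    k j * (pyramidsWithBasis G k i).ncard = k i * (pyramidsWithBasis G k j).ncard := by
  have h := congrArg (MvPowerSeries.coeff (Finsupp.equivFunOnFinite.symm k))
    (euler_eq_of_euler_eq_mul (heapSeries_ne_zero G) (euler_heapSeries G i)
      (euler_heapSeries G j))
  rw [coeff_euler, coeff_euler, coeff_pyramidSeries, coeff_pyramidSeries] at h
  exact_mod_cast h

end Series

end HeapsOfPieces

theorem mainTheorem3 {V : Type*} [Fintype V] [DecidableEq V] (G : SimpleGraph V) (k : V → ℕ) :
    (HeapsOfPieces.pyramids G k).Finite ∧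
    (∀ i : V, (HeapsOfPieces.pyramidsWithBasis G k i).Finite) ∧
    (∀ i : V, k i ≠ 0 →
      ((HeapsOfPieces.pyramids G k).ncard : ℚ) =
        (HeapsOfPieces.height k : ℚ) / (k i : ℚ) *
          ((HeapsOfPieces.pyramidsWithBasis G k i).ncard : ℚ)) ∧
    (∀ i j : V, k j ≠ 0 →
      ((HeapsOfPieces.pyramidsWithBasis G k i).ncard : ℚ) =
        (k i : ℚ) / (k j : ℚ) * ((HeapsOfPieces.pyramidsWithBasis G k j).ncard : ℚ)) ∧
    (∀ i j : V,
      k j * (HeapsOfPieces.pyramidsWithBasis G k i).ncard =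
        k i * (HeapsOfPieces.pyramidsWithBasis G k j).ncard) := by
  have key := HeapsOfPieces.mul_ncard_pyramidsWithBasis G k
  refine ⟨HeapsOfPieces.finite_pyramids G k, HeapsOfPieces.finite_pyramidsWithBasis G k,
    fun i hi => ?_, fun i j hj => ?_, key⟩
  -- The third claim summed over all bases `a`.
  · have h : k i * (HeapsOfPieces.pyramids G k).ncard =
        HeapsOfPieces.height k * (HeapsOfPieces.pyramidsWithBasis G k i).ncard := by
      rw [HeapsOfPieces.ncard_pyramids, Finset.mul_sum, HeapsOfPieces.height, Finset.sum_mul]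
      exact Finset.sum_congr rfl fun a _ => key a i
    rw [div_mul_eq_mul_div, eq_div_iff (Nat.cast_ne_zero.2 hi), mul_comm]
    exact_mod_cast h
  · rw [div_mul_eq_mul_div, eq_div_iff (Nat.cast_ne_zero.2 hj), mul_comm]
    exact_mod_cast key i j
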